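/- Let $1<p\le\infty$, let $X$ be a quasi-reflexive Banach space (i.e. $\dim X^{**}/X<\infty$), and let $A:X\to Y$ be a bounded linear operator into a Banach space $Y$, over the scalars $\mathbb K\in\{\mathbb R,\mathbb C\}$. Let $D_X$ be the set of weakly open subsets of $X$ containing $0$, directed by reverse inclusion. A weakly null tree of height $n$ in $B_X$ is a family $(x_t)\subset B_X$ indexed by the sequences $t$ in $D_X$ of length $1,\dots,n$, such that for every sequence $t$ in $D_X$ of length $<n$ (including the empty one) the net $(x_{t\smallfrown(u)})_{u\in D_X}$ is weakly null. For $a\in c_{00}$ put $$\Big\|\sum_i a_ie_i\Big\|_{0,A}=\sup\Big\{\inf_{t\in D_X^n}\Big\|A\sum_{i=1}^n a_ix_{(t_1,\dots,t_i)}\Big\| : n\in\mathbb N,\ (x_t)\text{ a weakly null tree of height } n \text{ in } B_X\Big\}.$$ With $1/p+1/q=1$, let $$\alpha_{0,p}(A)=\sup_n\sup\Big\{\Big\|\sum_{i=1}^n a_ie_i\Big\|_{0,A}:\ a\in B_{\ell_p^n}\Big\},\qquad N_{0,p}(A)=\sup_n n^{1/q}\Big\|\frac1n\sum_{i=1}^n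 e_i\Big\|_{0,A},$$ and write $A\in\mathfrak A_{0,p}$ if $\alpha_{0,p}(A)<\infty$, and $A\in\mathfrak N_{0,p}$ if $N_{0,p}(A)<\infty$. For positive $w_1,\dots,w_k$ let $G_k^w$ be the set $\mathbb N^k$ with the metric $d(\bar m,\bar n)=\sum_{i:\,m_i\ne n_i}w_i$, and let $G_k$ be $G_k^w$ for $w=(1,\dots,1)$. $\mathrm{Lip}(f)$ is the least Lipschitz constant of $f$, and $k^{1/\infty}=1$. (i) For any $k\in\mathbb N$, any positive $w_1,\dots,w_k$, any $\vartheta>2\|\sum_{i=1}^k w_ie_i\|_{0,A}$ and any Lipschitz map $f:G_k^w\to X$, there is an infinite $M\subset\mathbb N$ such that for all $m_1<n_1<\dots<m_k<n_k$ in $M$, $$\|Af(m_1,\dots,m_k)-Af(n_1,\dots,n_k)\|\le \mathrm{Lip}(f)\,\vartheta .$$ (ii) If $A\in\mathfrak A_{0,p}$ and $\alpha_{0,p}(A)>0$, then for any $\vartheta>2$, any $k\in\mathbb N$, any positive $w_1,\dots,w_k$ and any Lipschitz map $f:G_k^w\to X$, there is an infinite $M\subset\mathbb N$ such that for all $m_1<n_1<\dots<m_k<n_k$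 in $M$, $$\|Af(m_1,\dots,m_k)-Af(n_1,\dots,n_k)\|\le \vartheta\,\mathrm{Lip}(f)\,\alpha_{0,p}(A)\,\|w\|_{\ell_p^k}.$$ (iii) If $A\in\mathfrak N_{0,p}$ and $N_{0,p}(A)>0$, then for any $\vartheta>2$, any $k\in\mathbb N$ and any Lipschitz map $f:G_k\to X$, there is an infinite $M\subset\mathbb N$ such that for all $m_1<n_1<\dots<m_k<n_k$ in $M$, $$\|Af(m_1,\dots,m_k)-Af(n_1,\dots,n_k)\|\le \vartheta\,\mathrm{Lip}(f)\,N_{0,p}(A)\,k^{1/p}.$$ -/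

import Mathlib

open Filter Topology
open scoped ENNReal

noncomputable section

namespace AsymptoticSmoothness

section Spaces

variable (𝕜 : Type*) [RCLike 𝕜] (X : Type*) [NormedAddCommGroup X] [NormedSpace 𝕜 X]

set_option maxSynthPendingDepth 3 in
/-- `X` is quasi-reflexive: the quotient of the bidual `X**` by the canonical image of `X` is finite
dimensional (reflexive spaces are included). -/
def QuasiReflexive : Prop :=
  FiniteDimensional 𝕜 (StrongDual 𝕜 (StrongDual 𝕜 X) ⧸
    (NormedSpace.inclusionInDoubleDual 𝕜 X).range)

/-- The directed set `D_X` of weakly open subsets of `X` containing `0`, ordered by reverse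
inclusion. -/
abbrev WeakNhd : Type _ := (TopologicalSpace.OpenNhdsOf (0 : WeakSpace 𝕜 X))ᵒᵈ

variable {X}

/-- A weakly null collection `(x_t)` in the closed unit ball of `X`, indexed by the sequences `t` in
`D_X` of length `1, …, n`. (The tree `Γ_{0,n}` is the single chain
`(n-1), (n-1,n-2), …, (n-1,…,0)`, so the members of `Γ_{0,n}.D_X` are the sequences in `D_X` of
length between `1` and `n`, and the `i`-th level consists of those of length `i`.)
Values of `x` at other lists are irrelevant. -/
def IsWeaklyNullTree (n : ℕ) (x : List (WeakNhd 𝕜 X) → X) : Prop :=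
  (∀ t, t ≠ [] → t.length ≤ n → ‖x t‖ ≤ 1) ∧
  ∀ t : List (WeakNhd 𝕜 X), t.length < n →
    Tendsto (fun u : WeakNhd 𝕜 X => toWeakSpace 𝕜 X (x (t ++ [u]))) atTop (𝓝 0)

end Spaces

section Operators

variable {𝕜 : Type*} [RCLike 𝕜]
  {X : Type*} [NormedAddCommGroup X] [NormedSpace 𝕜 X]
  {Y : Type*} [NormedAddCommGroup Y] [NormedSpace 𝕜 Y]

/-- The vector `∑ a_i e_i` of `c₀₀` (coordinates are indexed from `0`). -/
def toC00 {n : ℕ} (a : Fin n → 𝕜) : ℕ →₀ 𝕜 :=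
  ∑ i : Fin n, Finsupp.single (i : ℕ) (a i)

/-- The seminorm `‖∑ a_i e_i‖_{0,A}` on `c₀₀`: the supremum over `n` and over weakly null trees
`(x_t)` of height `n` in the unit ball of `X` of the infimum over the maximal branches `t` of
`‖A ∑_{i ≤ n} a_i x_{t|i}‖`. -/
def asymNorm (A : X →L[𝕜] Y) (a : ℕ →₀ 𝕜) : ℝ≥0∞ :=
  ⨆ (n : ℕ) (x : List (WeakNhd 𝕜 X) → X) (_ : IsWeaklyNullTree 𝕜 n x),
    ⨅ (t : List (WeakNhd 𝕜 X)) (_ : t.length = n),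
      ‖A (∑ i ∈ Finset.range n, a i • x (t.take (i + 1)))‖ₑ

/-- `α_{0,p}(A)`: the supremum over `n` and `a` in the closed unit ball of `ℓ_p^n` of
`‖∑ a_i e_i‖_{0,A}`. -/
def alpha (p : ℝ≥0∞) (A : X →L[𝕜] Y) : ℝ≥0∞ :=
  ⨆ (n : ℕ) (a : PiLp p (fun _ : Fin n => 𝕜)) (_ : ‖a‖ ≤ 1), asymNorm A (toC00 (fun i => a i))

/-- `θ_{0,n}(A) = ‖n⁻¹ ∑_{i ≤ n} e_i‖_{0,A}`. -/
def theta (n : ℕ) (A : X →L[𝕜] Y) : ℝ≥0∞ :=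
  asymNorm A (toC00 (fun _ : Fin n => (n : 𝕜)⁻¹))

/-- `N_{0,p}(A) = sup_n n^{1/q} θ_{0,n}(A)`, where `1/q = 1 - 1/p` (and `1/∞ = 0`). -/
def bigN (p : ℝ≥0∞) (A : X →L[𝕜] Y) : ℝ≥0∞ :=
  ⨆ (n : ℕ) (_ : 1 ≤ n), (n : ℝ≥0∞) ^ (1 - (p⁻¹).toReal) * theta n A

/-- The class `𝔄_{0,p}`. -/
def ClassA (p : ℝ≥0∞) (A : X →L[𝕜] Y) : Prop := alpha p A < ∞

/-- The class `𝔑_{0,p}`. -/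
def ClassN (p : ℝ≥0∞) (A : X →L[𝕜] Y) : Prop := bigN p A < ∞

end Operators

section Graphs

variable {k : ℕ} {X : Type*} [NormedAddCommGroup X]

/-- The metric of `G_k^w`, whose points are all sequences of length `k` in `ℕ`:
`d(m, n) = ∑_{i : m_i ≠ n_i} w_i`. -/
def graphDist (w : Fin k → ℝ) (m n : Fin k → ℕ) : ℝ :=
  ∑ i with m i ≠ n i, w i

/-- `C ≥ 0` is a Lipschitz constant of `f : G_k^w → X`. -/
def IsLipConst (w : Fin k → ℝ) (f : (Fin k → ℕ) → X) (C : ℝ) : Prop :=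
  0 ≤ C ∧ ∀ m n, ‖f m - f n‖ ≤ C * graphDist w m n

/-- `f : G_k^w → X` is Lipschitz. -/
def IsLipschitz (w : Fin k → ℝ) (f : (Fin k → ℕ) → X) : Prop := ∃ C, IsLipConst w f C

/-- `Lip(f)`, the least Lipschitz constant of `f : G_k^w → X`. -/
def lip (w : Fin k → ℝ) (f : (Fin k → ℕ) → X) : ℝ := sInf {C | IsLipConst w f C}

/-- `m_1 < n_1 < m_2 < n_2 < ⋯ < m_k < n_k`. -/
def Interlaced (m n : Fin k → ℕ) : Prop :=
  (∀ i, m i < n i) ∧ ∀ i j, i < j → n i < m j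

end Graphs

end AsymptoticSmoothness

end

/-! Fix a free ultrafilter `U` on `ℕ`, view `f` in the bidual, and let `G j` be its iterated weak*
limit along `U` in all coordinates but the first `j`. Then `G 0` is constant, `G k` is `f`, and `f m
- f n` telescopes into the sum over `j` of `dm - dn`, where `dm` and `dn` are the increments of `G`
along `m` and `n`. The Lipschitz bound gives `‖dm - dn‖ ≤ 2 C w_j`, and each increment is weak* null
in its last coordinate.

These differences lie in the bidual, whereas a tree needs vectors of `X`. By quasi-reflexivity,
bounded sets of the bidual are totally bounded modulo `X`. So along generic sequences each `G j`
stays near one class modulo `X`, and this class cancels between `m` and `n`. Goldstine's theorem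
then replaces `dm - dn` by a nearby vector of `X` that is still small on finitely many prescribed
functionals.

If the estimate failed for generic interlaced pairs, this would answer any successive weak
neighbourhoods of `0`, giving a weakly null tree with `‖A ∑ w_i x_i‖` almost `C ϑ / (2 C)` on every
branch, against `2 ‖∑ w_i e_i‖ < ϑ` (`le_asymNorm_of_iterEventually`). Hence it holds generically,
and Ramsey's theorem yields `M`. Parts (ii) and (iii) follow by homogeneity of the seminorm. -/

namespace AsymptoticSmoothness

/-! ### Generic sequences along an ultrafilter, and Ramsey's theorem -/

section Combinatorics

variable {U : Ultrafilter ℕ}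

/-- `IterEventually U P l i s`: for `U`-most values of the coordinate `i`, for `U`-most values of
the coordinate `i + 1`, …, for `U`-most values of the coordinate `i + l - 1`, the sequence obtained
from `s` by replacing these `l` coordinates satisfies `P`. -/
def IterEventually (U : Ultrafilter ℕ) (P : (ℕ → ℕ) → Prop) : ℕ → ℕ → (ℕ → ℕ) → Prop
  | 0, _, s => P s
  | l + 1, i, s => ∀ᶠ x in (U : Filter ℕ), IterEventually U P l (i + 1) (Function.update s i x)

/-- `g s` depends only on the coordinates of `s` below `L`. -/
def DependsBelow (L : ℕ) {β : Type*} (g : (ℕ → ℕ) → β) : Prop :=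
  ∀ s s' : ℕ → ℕ, (∀ j < L, s j = s' j) → g s = g s'

theorem update_agree {s s' : ℕ → ℕ} {i : ℕ} (h : ∀ j < i, s j = s' j) (x : ℕ) :
    ∀ j < i + 1, Function.update s i x j = Function.update s' i x j := by
  intro j hj
  rcases eq_or_ne j i with rfl | hne
  · simp
  · rw [Function.update_of_ne hne, Function.update_of_ne hne]
    exact h j (by omega)

theorem IterEventually.dependsBelow {P : (ℕ → ℕ) → Prop} :
    ∀ (l i : ℕ), DependsBelow (i + l) P → DependsBelow i (IterEventually U P l i) := by
  intro l
  induction l with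
  | zero => intro i hP; exact hP
  | succ l ih =>
    intro i hP s s' h
    have := ih (i + 1) (by rwa [add_right_comm, add_assoc])
    simp only [IterEventually]
    congr! 2 with x
    exact iff_of_eq (this _ _ (update_agree h x))

theorem IterEventually.mono {P Q : (ℕ → ℕ) → Prop} (h : ∀ s, P s → Q s) :
    ∀ (l i : ℕ) (s : ℕ → ℕ), IterEventually U P l i s → IterEventually U Q l i s := by
  intro l
  induction l with
  | zero => intro i s hs; exact h s hs
  | succ l ih => intro i s hs; exact Eventually.mono hs fun x hx => ih _ _ hx

theorem IterEventually.and {P Q : (ℕ → ℕ) → Prop} :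
    ∀ (l i : ℕ) (s : ℕ → ℕ), IterEventually U P l i s → IterEventually U Q l i s →
      IterEventually U (fun s => P s ∧ Q s) l i s := by
  intro l
  induction l with
  | zero => intro i s hs hs'; exact ⟨hs, hs'⟩
  | succ l ih =>
    intro i s hs hs'
    filter_upwards [hs, hs'] with x hx hx' using ih _ _ hx hx'

theorem IterEventually.of_forall {P : (ℕ → ℕ) → Prop} (h : ∀ s, P s) :
    ∀ (l i : ℕ) (s : ℕ → ℕ), IterEventually U P l i s := by
  intro l
  induction l with
  | zero => intro i s; exact h s
  | succ l ih => intro i s; exact Eventually.of_forall fun x => ih _ _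

theorem IterEventually.forall_lt {P : ℕ → (ℕ → ℕ) → Prop} {l i : ℕ} {s : ℕ → ℕ} {k : ℕ}
    (h : ∀ j < k, IterEventually U (P j) l i s) :
    IterEventually U (fun s => ∀ j < k, P j s) l i s := by
  induction k with
  | zero => exact IterEventually.of_forall (by simp) _ _ _
  | succ k ih =>
    refine IterEventually.mono ?_ _ _ _
      (IterEventually.and _ _ _ (ih fun j hj => h j (by omega)) (h k (by omega)))
    rintro s ⟨h1, h2⟩ j hj
    rcases Nat.lt_succ_iff_lt_or_eq.1 hj with hj | rfl
    exacts [h1 j hj, h2]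

theorem IterEventually.not {P : (ℕ → ℕ) → Prop} :
    ∀ (l i : ℕ) (s : ℕ → ℕ), ¬ IterEventually U P l i s →
      IterEventually U (fun s => ¬ P s) l i s := by
  intro l
  induction l with
  | zero => intro i s hs; exact hs
  | succ l ih =>
    intro i s hs
    exact Eventually.mono (Ultrafilter.eventually_not.2 hs) fun x hx => ih _ _ hx

/-- Pigeonhole: an ultrafilter containing a finite union contains one of its members, at each level
of the iteration. -/
theorem IterEventually.exists_color {β : Type*} {T : Set β} (hT : T.Finite)
    {P : β → (ℕ → ℕ) → Prop} :
    ∀ (l i : ℕ) (s : ℕ → ℕ), IterEventually U (fun s => ∃ c ∈ T, P c s) l i s →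
      ∃ c ∈ T, IterEventually U (P c) l i s := by
  intro l
  induction l with
  | zero => intro i s hs; exact hs
  | succ l ih =>
    intro i s hs
    exact (Ultrafilter.eventually_exists_mem_iff hT).1
      (Eventually.mono hs fun x hx => ih _ _ hx)

/-- Turns a generic property that depends only on the coordinates already fixed into a true
statement about them. -/
theorem IterEventually.exists_agree {P : (ℕ → ℕ) → Prop} :
    ∀ (l i : ℕ) (s : ℕ → ℕ), IterEventually U P l i s → ∃ s', (∀ j < i, s' j = s j) ∧ P s' := by
  intro l
  induction l with
  | zero => intro i s hs; exact ⟨s, fun _ _ => rfl, hs⟩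
  | succ l ih =>
    intro i s hs
    obtain ⟨x, hx⟩ := Eventually.exists hs
    obtain ⟨s', h1, h2⟩ := ih _ _ hx
    refine ⟨s', fun j hj => ?_, h2⟩
    rw [h1 j (by omega), Function.update_of_ne (by omega)]

/-- The terms of a sequence at the even places. -/
def evens (s : ℕ → ℕ) : ℕ → ℕ := fun i => s (2 * i)

/-- The terms of a sequence at the odd places. -/
def odds (s : ℕ → ℕ) : ℕ → ℕ := fun i => s (2 * i + 1)

theorem evens_update_update (s : ℕ → ℕ) (i a b : ℕ) :
    evens (Function.update (Function.update s (2 * i) a) (2 * i + 1) b) =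
      Function.update (evens s) i a := by
  ext j
  simp only [evens]
  rcases eq_or_ne j i with rfl | h
  · simp
  · rw [Function.update_of_ne (by omega), Function.update_of_ne (by omega),
      Function.update_of_ne h]
    rfl

theorem odds_update_update (s : ℕ → ℕ) (i a b : ℕ) :
    odds (Function.update (Function.update s (2 * i) a) (2 * i + 1) b) =
      Function.update (odds s) i b := by
  ext j
  simp only [odds]
  rcases eq_or_ne j i with rfl | h
  · simp
  · rw [Function.update_of_ne (by omega), Function.update_of_ne (by omega),
      Function.update_of_ne h]
    rfl

/-- The quantifiers over odd places are dummy, so what is generic for one sequence is generic for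
each half of an interlaced pair. -/
theorem IterEventually.evens {P : (ℕ → ℕ) → Prop} :
    ∀ (l i : ℕ) (s : ℕ → ℕ), IterEventually U P l i (evens s) →
      IterEventually U (fun s => P (AsymptoticSmoothness.evens s)) (2 * l) (2 * i) s := by
  intro l
  induction l with
  | zero => intro i s hs; exact hs
  | succ l ih =>
    intro i s hs
    refine Eventually.mono hs fun a ha => Eventually.of_forall fun b => ?_
    refine ih (i + 1) _ ?_
    rwa [evens_update_update]

theorem IterEventually.odds {P : (ℕ → ℕ) → Prop} :
    ∀ (l i : ℕ) (s : ℕ → ℕ), IterEventually U P l i (odds s) →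
      IterEventually U (fun s => P (AsymptoticSmoothness.odds s)) (2 * l) (2 * i) s := by
  intro l
  induction l with
  | zero => intro i s hs; exact hs
  | succ l ih =>
    intro i s hs
    refine Eventually.of_forall fun a => Eventually.mono hs fun b hb => ?_
    refine ih (i + 1) _ ?_
    rwa [odds_update_update]

/-- Every increasing initial segment with values in `F` can be continued generically so that `P`
holds. -/
def GoodSet (U : Ultrafilter ℕ) (P : (ℕ → ℕ) → Prop) (L : ℕ) (F : Set ℕ) : Prop :=
  ∀ i l : ℕ, i + l = L → ∀ s : ℕ → ℕ, (∀ j < i, s j ∈ F) → (∀ j < i, ∀ j' < j, s j' < s j) →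
    IterEventually U P l i s

/-- Once `x` exceeds all of `F`, a new increasing segment must end in `x`. Only finitely many
segments from `F` precede it, so finitely many `U`-large conditions on `x` suffice. -/
theorem GoodSet.eventually_insert {P : (ℕ → ℕ) → Prop} {L : ℕ} (hU : (U : Filter ℕ) ≤ atTop)
    (hP : DependsBelow L P) {F : Finset ℕ} (hF : GoodSet U P L (F : Set ℕ)) :
    ∀ᶠ x in (U : Filter ℕ), (∀ y ∈ F, y < x) ∧ GoodSet U P L (insert x F : Finset ℕ) := by
  have h1 : ∀ᶠ x in (U : Filter ℕ), ∀ y ∈ F, y < x :=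
    (eventually_all_finset F).2 fun y _ => hU (eventually_gt_atTop y)
  have h2 : ∀ᶠ x in (U : Filter ℕ), ∀ i : Fin L, ∀ g : Fin i → F,
      (∀ j j', j' < j → (g j' : ℕ) < g j) →
        IterEventually U P (L - (i + 1)) (i + 1)
          (Function.update (fun j => if h : j < i then (g ⟨j, h⟩ : ℕ) else 0) i x) := by
    refine eventually_all.2 fun i => eventually_all.2 fun g => ?_
    by_cases hg : ∀ j j', j' < j → (g j' : ℕ) < g j
    · have := hF i (L - (i + 1) + 1) (by omega)
        (fun j => if h : j < i then (g ⟨j, h⟩ : ℕ) else 0)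
        (fun j hj => by simp [hj])
        (fun j hj j' hj' => by
          simp only [hj, hj'.trans hj, dif_pos]
          exact hg _ _ hj')
      exact Eventually.mono this fun x hx _ => hx
    · exact Eventually.of_forall fun x h => absurd h hg
  filter_upwards [h1, h2] with x hx1 hx2
  refine ⟨hx1, fun i l hil s hs hmono => ?_⟩
  by_cases hall : ∀ j < i, s j ∈ F
  · exact hF i l hil s hall hmono
  push Not at hall
  obtain ⟨j₀, hj₀, hj₀F⟩ := hall
  have hj₀x : s j₀ = x := by
    have := hs j₀ hj₀
    simp only [Finset.coe_insert, Set.mem_insert_iff, Finset.mem_coe] at this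
    exact this.resolve_right hj₀F
  -- A term after the value `x` would have to exceed every element of `insert x F`.
  have hi : i = j₀ + 1 := by
    by_contra hne
    have h3 : s j₀ < s (j₀ + 1) := hmono (j₀ + 1) (by omega) j₀ (by omega)
    have h4 := hs (j₀ + 1) (by omega)
    simp only [Finset.coe_insert, Set.mem_insert_iff, Finset.mem_coe] at h4
    rcases h4 with h4 | h4
    · omega
    · have := hx1 _ h4; omega
  subst hi
  have hF' : ∀ j < j₀, s j ∈ F := by
    intro j hj
    have h3 := hmono j₀ hj₀ j hj
    have h4 := hs j (by omega)
    simp only [Finset.coe_insert, Set.mem_insert_iff, Finset.mem_coe] at h4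
    rcases h4 with h4 | h4
    · omega
    · exact h4
  have key := hx2 ⟨j₀, by omega⟩ (fun j => ⟨s j, hF' j j.2⟩)
    (fun j j' h => hmono j (by have := j.2; simp only at this; omega) j' h)
  have hl : L - (j₀ + 1) = l := by omega
  simp only [hl] at key
  refine cast (IterEventually.dependsBelow l (j₀ + 1) (by rwa [hil]) _ _ ?_) key
  intro j hj
  rcases eq_or_ne j j₀ with rfl | hne
  · simp [hj₀x]
  · rw [Function.update_of_ne hne]
    have : j < j₀ := by omega
    simp [this]

/-- **Ramsey's theorem** in the form given by a free ultrafilter. -/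
theorem IterEventually.exists_infinite {P : (ℕ → ℕ) → Prop} {L : ℕ}
    (hU : (U : Filter ℕ) ≤ atTop) (hP : DependsBelow L P) {s₀ : ℕ → ℕ}
    (h : IterEventually U P L 0 s₀) :
    ∃ M : Set ℕ, M.Infinite ∧ ∀ s : ℕ → ℕ, (∀ j < L, s j ∈ M) →
      (∀ j < L, ∀ j' < j, s j' < s j) → P s := by
  have h0 : GoodSet U P L ((∅ : Finset ℕ) : Set ℕ) := by
    intro i l hil s hs _
    have hi : i = 0 := by
      by_contra hne
      simpa using hs 0 (by omega)
    subst hi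
    obtain rfl : l = L := by omega
    exact cast (IterEventually.dependsBelow l 0 (by rwa [hil]) s₀ s (by simp)) h
  have hstep : ∀ F : {F : Finset ℕ // GoodSet U P L (F : Set ℕ)},
      ∃ F' : {F : Finset ℕ // GoodSet U P L (F : Set ℕ)}, F.1 ⊂ F'.1 := by
    intro F
    obtain ⟨x, hx1, hx2⟩ := (F.2.eventually_insert hU hP).exists
    exact ⟨⟨_, hx2⟩, Finset.ssubset_insert fun hx => lt_irrefl _ (hx1 x hx)⟩
  choose next hnext using hstep
  let Fs : ℕ → {F : Finset ℕ // GoodSet U P L (F : Set ℕ)} := fun n => next^[n] ⟨∅, h0⟩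
  have hFs : ∀ n, (Fs n).1 ⊂ (Fs (n + 1)).1 := by
    intro n
    have : Fs (n + 1) = next (Fs n) := Function.iterate_succ_apply' _ _ _
    rw [this]
    exact hnext _
  have hsm : StrictMono fun n => (Fs n).1 := strictMono_nat_of_lt_succ hFs
  refine ⟨⋃ n, ((Fs n).1 : Set ℕ), ?_, fun s hs hmono => ?_⟩
  · intro hfin
    have hcard : StrictMono fun n => (Fs n).1.card := fun a b hab => Finset.card_lt_card (hsm hab)
    have h1 := hcard.le_apply (x := hfin.toFinset.card + 1)
    have h2 : (Fs (hfin.toFinset.card + 1)).1.card ≤ hfin.toFinset.card :=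
      Finset.card_le_card fun x hx => by
        rw [Set.Finite.mem_toFinset]
        exact Set.mem_iUnion.2 ⟨_, hx⟩
    have h3 : hfin.toFinset.card + 1 ≤ (Fs (hfin.toFinset.card + 1)).1.card := h1
    omega
  · have : ∃ n, ∀ j < L, s j ∈ (Fs n).1 := by
      have h1 : ∀ j, ∃ n, j < L → s j ∈ (Fs n).1 := by
        intro j
        by_cases hj : j < L
        · obtain ⟨n, hn⟩ := Set.mem_iUnion.1 (hs j hj)
          exact ⟨n, fun _ => hn⟩
        · exact ⟨0, fun h => absurd h hj⟩
      choose N hN using h1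
      refine ⟨(Finset.range L).sup N, fun j hj => ?_⟩
      exact hsm.monotone (Finset.le_sup (Finset.mem_range.2 hj)) (hN j hj)
    obtain ⟨n, hn⟩ := this
    exact (Fs n).2 L 0 (by simp) s hn hmono

end Combinatorics

end AsymptoticSmoothness

noncomputable section

namespace AsymptoticSmoothness

/-! ### Weak* limits, Goldstine's theorem and the bidual modulo `X` -/

section Duality

variable {𝕜 : Type*} [RCLike 𝕜]

theorem exists_weakStar_tendsto {E : Type*} [NormedAddCommGroup E] [NormedSpace 𝕜 E]
    (U : Ultrafilter ℕ) {g : ℕ → StrongDual 𝕜 E} {R : ℝ} (hg : ∀ n, ‖g n‖ ≤ R) :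
    ∃ z : StrongDual 𝕜 E, ∀ φ, Tendsto (fun n => g n φ) U (𝓝 (z φ)) := by
  have hc := WeakDual.isCompact_closedBall (𝕜 := 𝕜) (E := E) 0 R
  obtain ⟨z, -, hz⟩ := hc.ultrafilter_le_nhds (U.map fun n => StrongDual.toWeakDual (g n)) (by
    rw [le_principal_iff, Ultrafilter.mem_coe, Ultrafilter.mem_map]
    refine univ_mem' fun n => ?_
    simpa using hg n)
  refine ⟨WeakDual.toStrongDual z, fun φ => ?_⟩
  have h : Tendsto (fun n => StrongDual.toWeakDual (g n)) U (𝓝 z) := hz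
  exact ((WeakDual.eval_continuous φ).tendsto z).comp h

open scoped Classical in
/-- The weak* limit of a sequence of functionals along an ultrafilter (`0` if there is none). -/
def weakStarLim {E : Type*} [NormedAddCommGroup E] [NormedSpace 𝕜 E]
    (U : Ultrafilter ℕ) (g : ℕ → StrongDual 𝕜 E) : StrongDual 𝕜 E :=
  if h : ∃ z : StrongDual 𝕜 E, ∀ φ, Tendsto (fun n => g n φ) U (𝓝 (z φ)) then h.choose else 0

theorem tendsto_weakStarLim {E : Type*} [NormedAddCommGroup E] [NormedSpace 𝕜 E]
    (U : Ultrafilter ℕ) {g : ℕ → StrongDual 𝕜 E} {R : ℝ} (hg : ∀ n, ‖g n‖ ≤ R) (φ : E) :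
    Tendsto (fun n => g n φ) U (𝓝 (weakStarLim U g φ)) := by
  have h := exists_weakStar_tendsto U hg
  rw [weakStarLim, dif_pos h]
  exact h.choose_spec φ

theorem norm_le_of_weakStar_tendsto {E : Type*} [NormedAddCommGroup E] [NormedSpace 𝕜 E]
    {U : Ultrafilter ℕ} {g : ℕ → StrongDual 𝕜 E} {z : StrongDual 𝕜 E} {R : ℝ} (hR : 0 ≤ R)
    (hg : ∀ n, ‖g n‖ ≤ R) (hz : ∀ φ, Tendsto (fun n => g n φ) U (𝓝 (z φ))) : ‖z‖ ≤ R := by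
  refine z.opNorm_le_bound hR fun φ => ?_
  refine le_of_tendsto (hz φ).norm (Eventually.of_forall fun n => ?_)
  exact (g n).le_of_opNorm_le (hg n) φ

variable {X : Type*} [NormedAddCommGroup X] [NormedSpace 𝕜 X]

/-- **Goldstine's theorem**, for finitely many functionals. -/
theorem exists_norm_le_forall_mem_norm_sub_lt (e : StrongDual 𝕜 (StrongDual 𝕜 X)) {ε : ℝ}
    (hε : 0 < ε) (he : ‖e‖ ≤ ε) (F : Finset (StrongDual 𝕜 X)) {δ : ℝ} (hδ : 0 < δ) :
    ∃ y : X, ‖y‖ ≤ ε ∧ ∀ φ ∈ F, ‖φ y - e φ‖ < δ := by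
  let T : X →L[𝕜] (F → 𝕜) := ContinuousLinearMap.pi fun φ => (φ : StrongDual 𝕜 X)
  let e' : F → 𝕜 := fun φ => e φ
  -- A separating functional pulls back to a combination `ψ` of members of `F` with `‖ψ‖ ≤ u / ε`.
  -- Hence `‖e ψ‖ ≤ u`, contradicting the separation.
  have hmem : e' ∈ closure (T '' Metric.closedBall 0 ε) := by
    by_contra hnot
    have hconv : Convex ℝ (closure (T '' Metric.closedBall (0 : X) ε)) :=
      letI : NormedSpace ℝ X := NormedSpace.restrictScalars ℝ 𝕜 X
      ((convex_closedBall (0 : X) ε).is_linear_image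
        ((T.restrictScalars ℝ).toLinearMap.isLinear)).closure
    obtain ⟨g, u, hgu, hu⟩ := RCLike.geometric_hahn_banach_closed_point (𝕜 := 𝕜)
      hconv isClosed_closure hnot
    let ψ : StrongDual 𝕜 X := g.comp T
    have hψ : ∀ x ∈ Metric.closedBall (0 : X) ε, ‖ψ x‖ ≤ u := by
      intro x hx
      -- Rotating `x` by a unimodular scalar upgrades the bound on real parts to a bound on norms.
      obtain ⟨c, hc1, hc2⟩ := RCLike.exists_norm_eq_mul_self (ψ x)
      have h1 : T (c • x) ∈ closure (T '' Metric.closedBall (0 : X) ε) := by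
        refine subset_closure ⟨c • x, ?_, rfl⟩
        rw [mem_closedBall_zero_iff] at hx ⊢
        rwa [norm_smul, hc1, one_mul]
      have h2 := hgu _ h1
      have h3 : g (T (c • x)) = ((‖ψ x‖ : ℝ) : 𝕜) := by
        rw [hc2, map_smul, map_smul, smul_eq_mul]; rfl
      rw [h3, RCLike.ofReal_re] at h2
      exact h2.le
    have hu0 : 0 ≤ u := (norm_nonneg _).trans (hψ 0 (by simpa using hε.le))
    have hψn : ‖ψ‖ ≤ u / ε :=
      ContinuousLinearMap.opNorm_bound_of_ball_bound hε u ψ hψ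
    have hge : g e' = e ψ := by
      classical
      have h1 : ∀ v : F → 𝕜, g v = ∑ φ, v φ * g (Pi.single φ 1) := by
        intro v
        conv_lhs => rw [pi_eq_sum_univ' v]
        simp [map_sum, map_smul]
      have h2 : ψ = ∑ φ : F, g (Pi.single φ 1) • (φ : StrongDual 𝕜 X) := by
        ext x
        change g (T x) = _
        rw [h1 (T x)]
        simp [T, mul_comm]
      rw [h1 e', h2, map_sum]
      simp [e', mul_comm]
    rw [hge] at hu
    have h4 : ‖e ψ‖ ≤ ε * (u / ε) := by
      refine (e.le_of_opNorm_le he ψ).trans ?_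
      gcongr
    rw [mul_div_cancel₀ _ hε.ne'] at h4
    linarith [RCLike.re_le_norm (e ψ)]
  obtain ⟨_, ⟨y, hy, rfl⟩, hdist⟩ := Metric.mem_closure_iff.1 hmem δ hδ
  refine ⟨y, by simpa using hy, fun φ hφ => ?_⟩
  have := (dist_pi_lt_iff hδ).1 hdist ⟨φ, hφ⟩
  rwa [dist_comm, dist_eq_norm] at this

/-- An element of the bidual close to `X` and small on finitely many functionals is approximated by
an element of `X` which is small on these functionals. -/
theorem exists_norm_inclusion_sub_le {z : StrongDual 𝕜 (StrongDual 𝕜 X)} {y : X} {ε δ : ℝ}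
    (hε : 0 < ε) (hδ : 0 < δ) (hy : ‖z - NormedSpace.inclusionInDoubleDual 𝕜 X y‖ ≤ ε)
    {F : Finset (StrongDual 𝕜 X)} (hF : ∀ φ ∈ F, ‖z φ‖ < δ) :
    ∃ x : X, ‖NormedSpace.inclusionInDoubleDual 𝕜 X x - z‖ ≤ 2 * ε ∧
      ∀ φ ∈ F, ‖φ x‖ < 2 * δ := by
  -- Correct `y` by a vector of norm at most `ε` imitating `z - y` on `F`; this doubles both `ε` and
  -- `δ`.
  obtain ⟨y', hy', hy'F⟩ := exists_norm_le_forall_mem_norm_sub_lt _ hε hy F hδ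
  refine ⟨y + y', ?_, fun φ hφ => ?_⟩
  · have : NormedSpace.inclusionInDoubleDual 𝕜 X (y + y') - z =
        NormedSpace.inclusionInDoubleDual 𝕜 X y' -
          (z - NormedSpace.inclusionInDoubleDual 𝕜 X y) := by
      rw [map_add]; abel
    rw [this]
    have h1 := norm_sub_le (NormedSpace.inclusionInDoubleDual 𝕜 X y')
      (z - NormedSpace.inclusionInDoubleDual 𝕜 X y)
    have h2 := NormedSpace.double_dual_bound 𝕜 X y'
    linarith
  · have h1 := hy'F φ hφ
    have h2 : φ (y + y') =
        (φ y' - (z - NormedSpace.inclusionInDoubleDual 𝕜 X y) φ) + z φ := by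
      rw [sub_apply, NormedSpace.dual_def, map_add]; ring
    rw [h2]
    have h3 := norm_add_le (φ y' - (z - NormedSpace.inclusionInDoubleDual 𝕜 X y) φ) (z φ)
    linarith [hF φ hφ]

theorem norm_inclusionInDoubleDual (x : X) :
    ‖NormedSpace.inclusionInDoubleDual 𝕜 X x‖ = ‖x‖ :=
  (NormedSpace.inclusionInDoubleDualLi (E := X) 𝕜).norm_map x

set_option maxSynthPendingDepth 3 in
/-- In a quasi-reflexive space, bounded subsets of the bidual are totally bounded modulo `X`. -/
theorem QuasiReflexive.exists_finite_net [CompleteSpace X] (hX : QuasiReflexive 𝕜 X) (R : ℝ)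
    {ε : ℝ} (hε : 0 < ε) :
    ∃ T : Set (StrongDual 𝕜 (StrongDual 𝕜 X)), T.Finite ∧
      ∀ z : StrongDual 𝕜 (StrongDual 𝕜 X), ‖z‖ ≤ R →
        ∃ c ∈ T, ∃ x : X, ‖z - c - NormedSpace.inclusionInDoubleDual 𝕜 X x‖ < ε := by
  -- Completeness makes the image of `X` closed, so the quotient is a finite-dimensional normed
  -- space and its balls are compact. Representatives of the centres of a finite cover form `T`.
  have hclosed : IsClosed (((NormedSpace.inclusionInDoubleDual 𝕜 X).range :
      Submodule 𝕜 (StrongDual 𝕜 (StrongDual 𝕜 X))) : Set (StrongDual 𝕜 (StrongDual 𝕜 X))) := by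
    have h := (NormedSpace.inclusionInDoubleDualLi (E := X) 𝕜).isometry.isClosedEmbedding.isClosed_range
    exact h
  have hfin : FiniteDimensional 𝕜 (StrongDual 𝕜 (StrongDual 𝕜 X) ⧸
    (NormedSpace.inclusionInDoubleDual 𝕜 X).range) := hX
  have hprop : ProperSpace (StrongDual 𝕜 (StrongDual 𝕜 X) ⧸
    (NormedSpace.inclusionInDoubleDual 𝕜 X).range) := FiniteDimensional.proper 𝕜 _
  obtain ⟨t, -, htfin, ht⟩ := (isCompact_closedBall (0 : StrongDual 𝕜 (StrongDual 𝕜 X) ⧸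
    (NormedSpace.inclusionInDoubleDual 𝕜 X).range) R).finite_cover_balls hε
  refine ⟨Quotient.out '' t, htfin.image _, fun z hz => ?_⟩
  have hzR : (Submodule.Quotient.mk z : StrongDual 𝕜 (StrongDual 𝕜 X) ⧸
      (NormedSpace.inclusionInDoubleDual 𝕜 X).range) ∈ Metric.closedBall 0 R := by
    rw [mem_closedBall_zero_iff]
    exact (Submodule.Quotient.norm_mk_le _ _).trans hz
  obtain ⟨c, hc, hzc⟩ := Set.mem_iUnion₂.1 (ht hzR)
  refine ⟨Quotient.out c, ⟨c, hc, rfl⟩, ?_⟩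
  have hout : (Submodule.Quotient.mk (Quotient.out c) : StrongDual 𝕜 (StrongDual 𝕜 X) ⧸
      (NormedSpace.inclusionInDoubleDual 𝕜 X).range) = c := Quotient.out_eq c
  rw [Metric.mem_ball, dist_eq_norm, ← hout, ← Submodule.Quotient.mk_sub] at hzc
  obtain ⟨m, hm, hmn⟩ := QuotientAddGroup.norm_lt_iff.1 hzc
  have hm' : m - (z - Quotient.out c) ∈ (NormedSpace.inclusionInDoubleDual 𝕜 X).range :=
    (Submodule.Quotient.eq _).1 hm
  obtain ⟨x, hx⟩ := hm'
  refine ⟨-x, ?_⟩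
  have hx' : NormedSpace.inclusionInDoubleDual 𝕜 X x = m - (z - Quotient.out c) := hx
  rwa [map_neg, hx', sub_neg_eq_add, add_sub_cancel]

theorem exists_finset_forall_norm_lt_mem (u : WeakNhd 𝕜 X) :
    ∃ (F : Finset (StrongDual 𝕜 X)) (δ : ℝ), 0 < δ ∧
      ∀ x : X, (∀ φ ∈ F, ‖φ x‖ < δ) → toWeakSpace 𝕜 X x ∈ OrderDual.ofDual u := by
  have hu : ((OrderDual.ofDual u : TopologicalSpace.OpenNhdsOf (0 : WeakSpace 𝕜 X)) :
      Set (WeakSpace 𝕜 X)) ∈ 𝓝 (0 : WeakSpace 𝕜 X) :=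
    (OrderDual.ofDual u).isOpen.mem_nhds (OrderDual.ofDual u).mem'
  obtain ⟨V, hV, hVu⟩ :=
    ((topDualPairing 𝕜 X).flip.hasBasis_weakBilin.mem_iff).1 hu
  obtain ⟨F, δ, hδ, rfl⟩ := (SeminormFamily.basisSets_iff _).1 hV
  refine ⟨F, δ, hδ, fun x hx => hVu ?_⟩
  refine (Seminorm.mem_ball_zero (p := F.sup (topDualPairing 𝕜 X).flip.toSeminormFamily)
    (y := x) (r := δ)).2 ?_
  exact Seminorm.finset_sup_apply_lt hδ fun φ hφ => hx φ hφ

end Duality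

/-! ### Weakly null trees from strategies -/

section Strategy

variable {𝕜 : Type*} [RCLike 𝕜]
  {X : Type*} [NormedAddCommGroup X] [NormedSpace 𝕜 X]
  {Y : Type*} [NormedAddCommGroup Y] [NormedSpace 𝕜 Y]

theorem tendsto_toWeakSpace_of_mem {x : WeakNhd 𝕜 X → X}
    (hx : ∀ u, toWeakSpace 𝕜 X (x u) ∈ OrderDual.ofDual u) :
    Tendsto (fun u => toWeakSpace 𝕜 X (x u)) atTop (𝓝 0) := by
  refine tendsto_def.2 fun V hV => ?_
  obtain ⟨W, hWV, hWo, hW0⟩ := mem_nhds_iff.1 hV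
  let w : WeakNhd 𝕜 X := OrderDual.toDual ⟨⟨W, hWo⟩, hW0⟩
  filter_upwards [eventually_ge_atTop w] with u hu
  exact hWV (hu (hx u))

open scoped Classical in
/-- A lower bound for `asymNorm` from a strategy for choosing, in response to any `k` successive weak
neighbourhoods, vectors of the unit ball in these neighbourhoods; `I j v` is an invariant of the
partial sum `v` after `j` steps. -/
theorem le_asymNorm_of_strategy (A : X →L[𝕜] Y) (a : ℕ →₀ 𝕜) (k : ℕ) (c : ℝ≥0∞)
    (I : ℕ → X → Prop) (h0 : I 0 0)
    (hstep : ∀ j < k, ∀ v, I j v → ∀ u : WeakNhd 𝕜 X, ∃ x : X, ‖x‖ ≤ 1 ∧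
      toWeakSpace 𝕜 X x ∈ OrderDual.ofDual u ∧ I (j + 1) (v + a j • x))
    (hend : ∀ v, I k v → c ≤ ‖A v‖ₑ) : c ≤ asymNorm A a := by
  let nxt : ℕ → X → WeakNhd 𝕜 X → X := fun j v u =>
    if h : j < k ∧ I j v then (hstep j h.1 v h.2 u).choose else 0
  have hnxt : ∀ j v u, j < k → I j v → ‖nxt j v u‖ ≤ 1 ∧
      toWeakSpace 𝕜 X (nxt j v u) ∈ OrderDual.ofDual u ∧ I (j + 1) (v + a j • nxt j v u) := by
    intro j v u hj hv
    simp only [nxt, dif_pos (show j < k ∧ I j v from ⟨hj, hv⟩)]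
    exact (hstep j hj v hv u).choose_spec
  -- The state records the number of moves, the current partial sum and the last vector played; the
  -- last is the tree.
  let st : List (WeakNhd 𝕜 X) → ℕ × X × X := fun t =>
    t.foldl (fun q u => (q.1 + 1, q.2.1 + a q.1 • nxt q.1 q.2.1 u, nxt q.1 q.2.1 u)) (0, 0, 0)
  have hst : ∀ t u, st (t ++ [u]) = ((st t).1 + 1,
      (st t).2.1 + a (st t).1 • nxt (st t).1 (st t).2.1 u, nxt (st t).1 (st t).2.1 u) := by
    intro t u
    simp [st, List.foldl_append]
  have hlen : ∀ t, (st t).1 = t.length := by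
    intro t
    induction t using List.reverseRecOn with
    | nil => rfl
    | append_singleton t u ih => rw [hst]; simp [ih]
  have hI : ∀ t, t.length ≤ k → I t.length (st t).2.1 := by
    intro t
    induction t using List.reverseRecOn with
    | nil => intro _; exact h0
    | append_singleton t u ih =>
      intro ht
      simp only [List.length_append, List.length_singleton] at ht ⊢
      rw [hst]
      simp only [hlen]
      exact (hnxt _ _ u (by omega) (ih (by omega))).2.2
  have hsum : ∀ t, ∑ i ∈ Finset.range t.length, a i • (st (t.take (i + 1))).2.2 = (st t).2.1 := by
    intro t
    induction t using List.reverseRecOn with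
    | nil => simp [st]
    | append_singleton t u ih =>
      rw [List.length_append, List.length_singleton, Finset.sum_range_succ,
        List.take_of_length_le (l := t ++ [u]) (by simp), hst]
      simp only [hlen]
      rw [← ih]
      congr 1
      refine Finset.sum_congr rfl fun i hi => ?_
      rw [List.take_append_of_le_length (by simpa using hi)]
  have htree : IsWeaklyNullTree 𝕜 k fun t => (st t).2.2 := by
    refine ⟨fun t ht htk => ?_, fun t ht => ?_⟩
    · obtain ⟨t, u, rfl⟩ := List.eq_nil_or_concat' t |>.resolve_left ht
      simp only [List.length_append, List.length_singleton] at htk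
      simp only [hst, hlen]
      exact (hnxt _ _ u (by omega) (hI t (by omega))).1
    · refine tendsto_toWeakSpace_of_mem fun u => ?_
      simp only [hst, hlen]
      exact (hnxt _ _ u ht (hI t ht.le)).2.1
  refine le_iSup_of_le k (le_iSup_of_le _ (le_iSup_of_le htree ?_))
  refine le_iInf fun t => le_iInf fun ht => ?_
  subst ht
  rw [hsum]
  exact hend _ (hI t le_rfl)

end Strategy

end AsymptoticSmoothness

end

noncomputable section

namespace AsymptoticSmoothness

/-! ### Iterated weak* limits and their increments -/

section IteratedLimits

variable {𝕜 : Type*} [RCLike 𝕜] {E : Type*} [NormedAddCommGroup E] [NormedSpace 𝕜 E]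
  {U : Ultrafilter ℕ} {g : (ℕ → ℕ) → StrongDual 𝕜 E}

/-- The iterated weak* limit of `g` along `U` in the `l` coordinates `i, …, i + l - 1`, the last
coordinate going first. -/
def iterLim (U : Ultrafilter ℕ) (g : (ℕ → ℕ) → StrongDual 𝕜 E) :
    ℕ → ℕ → (ℕ → ℕ) → StrongDual 𝕜 E
  | 0, _, s => g s
  | l + 1, i, s => weakStarLim U fun x => iterLim U g l (i + 1) (Function.update s i x)

theorem norm_iterLim_le {R : ℝ} (hR : 0 ≤ R) (hg : ∀ s, ‖g s‖ ≤ R) :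
    ∀ (l i : ℕ) (s : ℕ → ℕ), ‖iterLim U g l i s‖ ≤ R := by
  intro l
  induction l with
  | zero => intro i s; exact hg s
  | succ l ih =>
    intro i s
    exact norm_le_of_weakStar_tendsto hR (fun x => ih (i + 1) (Function.update s i x))
      (tendsto_weakStarLim U fun x => ih (i + 1) (Function.update s i x))

theorem tendsto_iterLim {R : ℝ} (hR : 0 ≤ R) (hg : ∀ s, ‖g s‖ ≤ R) (l i : ℕ) (s : ℕ → ℕ)
    (φ : E) :
    Tendsto (fun x => iterLim U g l (i + 1) (Function.update s i x) φ) U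
      (𝓝 (iterLim U g (l + 1) i s φ)) :=
  tendsto_weakStarLim U (fun x => norm_iterLim_le hR hg l (i + 1) (Function.update s i x)) φ

theorem iterLim_dependsBelow :
    ∀ (l i : ℕ), DependsBelow (i + l) g → DependsBelow i (iterLim U g l i) := by
  intro l
  induction l with
  | zero => intro i hg; exact hg
  | succ l ih =>
    intro i hg s s' h
    have := ih (i + 1) (by rwa [add_right_comm, add_assoc])
    simp only [iterLim]
    congr 1
    funext x
    exact this _ _ (update_agree h x)

/-- Weak* limits are linear and do not increase norm bounds, and changing coordinate `j` commutes
with the limits in later coordinates. -/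
theorem norm_iterLim_update_sub_le {R D : ℝ} (hR : 0 ≤ R) (hg : ∀ s, ‖g s‖ ≤ R) {j : ℕ}
    (hD : ∀ s x y, ‖g (Function.update s j x) - g (Function.update s j y)‖ ≤ D) :
    ∀ (l i : ℕ), j < i → ∀ s x y,
      ‖iterLim U g l i (Function.update s j x) - iterLim U g l i (Function.update s j y)‖ ≤ D := by
  have hD0 : 0 ≤ D := (norm_nonneg _).trans (hD 0 0 0)
  intro l
  induction l with
  | zero => intro i _ s x y; exact hD s x y
  | succ l ih =>
    intro i hi s x y
    refine norm_le_of_weakStar_tendsto (U := U) hD0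
      (fun z => ih (i + 1) (by omega) (Function.update s i z) x y) fun φ => ?_
    have h1 := tendsto_iterLim (U := U) hR hg l i (Function.update s j x) φ
    have h2 := tendsto_iterLim (U := U) hR hg l i (Function.update s j y) φ
    have h3 := h1.sub h2
    simp only [sub_apply]
    refine h3.congr fun z => ?_
    rw [Function.update_comm hi.ne, Function.update_comm hi.ne]

theorem norm_iterLim_succ_sub_le {R D : ℝ} (hR : 0 ≤ R) (hg : ∀ s, ‖g s‖ ≤ R) {j : ℕ}
    (hD : ∀ s x y, ‖g (Function.update s j x) - g (Function.update s j y)‖ ≤ D) (l : ℕ)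
    (s : ℕ → ℕ) (x : ℕ) :
    ‖iterLim U g l (j + 1) (Function.update s j x) - iterLim U g (l + 1) j s‖ ≤ D := by
  have hD0 : 0 ≤ D := (norm_nonneg _).trans (hD 0 0 0)
  refine norm_le_of_weakStar_tendsto (U := U) hD0
    (fun y => norm_iterLim_update_sub_le (U := U) hR hg hD l (j + 1) (by omega) s x y) fun φ => ?_
  simp only [sub_apply]
  exact tendsto_const_nhds.sub (tendsto_iterLim hR hg l j s φ)

theorem eventually_norm_iterLim_succ_sub_lt {R δ : ℝ} (hR : 0 ≤ R) (hg : ∀ s, ‖g s‖ ≤ R)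
    (hδ : 0 < δ) (F : Finset E) (l j : ℕ) (s : ℕ → ℕ) :
    ∀ᶠ x in (U : Filter ℕ), ∀ φ ∈ F,
      ‖(iterLim U g l (j + 1) (Function.update s j x) - iterLim U g (l + 1) j s) φ‖ < δ := by
  refine (eventually_all_finset F).2 fun φ _ => ?_
  have := (tendsto_iterLim (U := U) hR hg l j s φ).eventually (Metric.ball_mem_nhds _ hδ)
  filter_upwards [this] with x hx
  rwa [dist_eq_norm] at hx

end IteratedLimits

/-! ### Lipschitz maps on weighted Hamming graphs -/

section Graphs

variable {k : ℕ} {w : Fin k → ℝ} {X : Type*} [NormedAddCommGroup X] {f : (Fin k → ℕ) → X} {C : ℝ}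

theorem IsLipConst.norm_update_sub_le (hC : IsLipConst w f C) (hw : ∀ i, 0 < w i) (j : Fin k)
    (s : ℕ → ℕ) (x y : ℕ) :
    ‖f (fun i => Function.update s j x i) - f (fun i => Function.update s j y i)‖ ≤ C * w j := by
  refine (hC.2 _ _).trans (mul_le_mul_of_nonneg_left ?_ hC.1)
  rw [graphDist, ← Finset.sum_singleton w j]
  refine Finset.sum_le_sum_of_subset_of_nonneg (fun i hi => ?_) fun i _ _ => (hw i).le
  rw [Finset.mem_singleton]
  by_contra hne
  have hne' : (i : ℕ) ≠ j := fun h => hne (Fin.ext h)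
  simp [Function.update_of_ne hne'] at hi

theorem IsLipConst.norm_le (hC : IsLipConst w f C) (hw : ∀ i, 0 < w i) (m : Fin k → ℕ) :
    ‖f m‖ ≤ ‖f 0‖ + C * ∑ i, w i := by
  have h1 : ‖f m - f 0‖ ≤ C * ∑ i, w i :=
    (hC.2 _ _).trans (mul_le_mul_of_nonneg_left
      (Finset.sum_le_sum_of_subset_of_nonneg (Finset.filter_subset _ _)
        fun i _ _ => (hw i).le) hC.1)
  have h2 := norm_add_le (f 0) (f m - f 0)
  rw [add_sub_cancel] at h2
  linarith

theorem isLipConst_lip (hf : IsLipschitz w f) : IsLipConst w f (lip w f) := by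
  have hbdd : BddBelow {C | IsLipConst w f C} := ⟨0, fun C hC => hC.1⟩
  have hclosed : IsClosed {C | IsLipConst w f C} := by
    simp only [IsLipConst, Set.ofPred_and, Set.ofPred_forall]
    exact isClosed_Ici.inter (isClosed_iInter fun m => isClosed_iInter fun n =>
      isClosed_le continuous_const (continuous_id.mul continuous_const))
  exact hclosed.csInf_mem hf hbdd

end Graphs

/-! ### The lower bound for the seminorm from generic separation -/

section Concentration

variable {𝕜 : Type*} [RCLike 𝕜]
  {X : Type*} [NormedAddCommGroup X] [NormedSpace 𝕜 X]
  {Y : Type*} [NormedAddCommGroup Y] [NormedSpace 𝕜 Y]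

theorem toC00_apply {n : ℕ} (a : Fin n → 𝕜) {j : ℕ} (hj : j < n) : toC00 a j = a ⟨j, hj⟩ := by
  rw [toC00, Finsupp.finsetSum_apply, Finset.sum_eq_single ⟨j, hj⟩]
  · simp
  · intro i _ hi
    exact Finsupp.single_eq_of_ne fun h => hi (Fin.ext h.symm)
  · simp

/-- Colour `G s` by the nearest point of a finite net modulo `X`. Generically the colour is one
fixed `c`, which cancels in the difference. -/
theorem iterEventually_near [CompleteSpace X] (hX : QuasiReflexive 𝕜 X) (U : Ultrafilter ℕ)
    {G : (ℕ → ℕ) → StrongDual 𝕜 (StrongDual 𝕜 X)} {R ε : ℝ} (hG : ∀ s, ‖G s‖ ≤ R) (hε : 0 < ε)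
    (k : ℕ) :
    IterEventually U (fun s => ∃ x : X,
      ‖G (evens s) - G (odds s) - NormedSpace.inclusionInDoubleDual 𝕜 X x‖ ≤ 2 * ε)
      (2 * k) 0 0 := by
  obtain ⟨T, hT, hnet⟩ := hX.exists_finite_net R hε
  obtain ⟨c, -, hc⟩ := IterEventually.exists_color (U := U) hT
    (P := fun c s => ∃ x : X, ‖G s - c - NormedSpace.inclusionInDoubleDual 𝕜 X x‖ < ε) k 0 0
    (IterEventually.of_forall (fun s => hnet (G s) (hG s)) _ _ _)
  refine IterEventually.mono ?_ _ _ _ (IterEventually.and _ _ _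
    (IterEventually.evens k 0 0 hc) (IterEventually.odds k 0 0 hc))
  rintro s ⟨⟨x, hx⟩, ⟨y, hy⟩⟩
  refine ⟨x - y, ?_⟩
  have : G (evens s) - G (odds s) - NormedSpace.inclusionInDoubleDual 𝕜 X (x - y) =
      (G (evens s) - c - NormedSpace.inclusionInDoubleDual 𝕜 X x) -
        (G (odds s) - c - NormedSpace.inclusionInDoubleDual 𝕜 X y) := by
    rw [map_sub]; abel
  rw [this]
  have := norm_sub_le (G (evens s) - c - NormedSpace.inclusionInDoubleDual 𝕜 X x)
    (G (odds s) - c - NormedSpace.inclusionInDoubleDual 𝕜 X y)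
  linarith

set_option maxSynthPendingDepth 3 in
/-- If `‖A f(m) - A f(n)‖ > b` for generic interlaced `m`, `n`, then `‖∑ w_i e_i‖_{0,A}` is bounded
below. -/
theorem le_asymNorm_of_iterEventually [CompleteSpace X] (hX : QuasiReflexive 𝕜 X) (A : X →L[𝕜] Y)
    (U : Ultrafilter ℕ) {k : ℕ} {w : Fin k → ℝ} (hw : ∀ i, 0 < w i) {f : (Fin k → ℕ) → X} {C : ℝ}
    (hC : IsLipConst w f C) {η ε b : ℝ} (hη : 0 < η) (hε : 0 < ε) (hεη : ∀ i, ε ≤ 2 * η * w i)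
    (hb : IterEventually U
      (fun s => b < ‖A (f fun i => evens s i) - A (f fun i => odds s i)‖) (2 * k) 0 0) :
    ENNReal.ofReal ((b - ‖A‖ * (k * ε)) / (2 * (C + η))) ≤
      asymNorm A (toC00 fun i => (w i : 𝕜)) := by
  have hC0 := hC.1
  set ι := NormedSpace.inclusionInDoubleDual 𝕜 X with hι
  -- `2 * C * w j` bounds `dm - dn`; the extra `2 * η * w j` absorbs the approximation error `ε`.
  set r : ℝ := 2 * (C + η) with hr
  have hr0 : 0 < r := by positivity
  let g : (ℕ → ℕ) → StrongDual 𝕜 (StrongDual 𝕜 X) := fun s => ι (f fun i => s i)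
  set R : ℝ := ‖f 0‖ + C * ∑ i, w i with hRdef
  have hg : ∀ s, ‖g s‖ ≤ R := fun s => by
    rw [norm_inclusionInDoubleDual]; exact hC.norm_le hw _
  have hR : 0 ≤ R := (norm_nonneg (g 0)).trans (hg 0)
  have hgdep : DependsBelow k g := by
    intro s s' h
    have : (fun i : Fin k => s i) = fun i : Fin k => s' i := funext fun i => h i i.2
    simp only [g, this]
  have hD : ∀ (j : Fin k) (s : ℕ → ℕ) (x y : ℕ),
      ‖g (Function.update s j x) - g (Function.update s j y)‖ ≤ C * w j := by
    intro j s x y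
    simp only [g]
    rw [← map_sub, norm_inclusionInDoubleDual]
    exact hC.norm_update_sub_le hw j s x y
  let G : ℕ → (ℕ → ℕ) → StrongDual 𝕜 (StrongDual 𝕜 X) := fun j => iterLim U g (k - j) j
  have hGdep : ∀ j ≤ k, DependsBelow j (G j) := fun j hj =>
    iterLim_dependsBelow _ _ (by rwa [Nat.add_sub_cancel' hj])
  have hGk : ∀ s, G k s = g s := fun s => by simp only [G, Nat.sub_self]; rfl
  let Q : (ℕ → ℕ) → Prop := fun s =>
    b < ‖A (f fun i => evens s i) - A (f fun i => odds s i)‖ ∧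
      ∀ j < k + 1, ∃ x : X, ‖G j (evens s) - G j (odds s) - ι x‖ ≤ 2 * (ε / 8)
  have hQ : IterEventually U Q (2 * k) 0 0 :=
    IterEventually.and _ _ _ hb (IterEventually.forall_lt fun j _ =>
      iterEventually_near hX U (fun s => norm_iterLim_le hR hg (k - j) j s) (by positivity) k)
  have hnear : ∀ j ≤ k, ∀ l s, IterEventually U Q l (2 * j) s →
      ∃ x : X, ‖G j (evens s) - G j (odds s) - ι x‖ ≤ 2 * (ε / 8) := by
    intro j hj l s hs
    obtain ⟨s', hss', hs'⟩ := IterEventually.exists_agree _ _ _ hs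
    have h1 : G j (evens s') = G j (evens s) :=
      hGdep j hj _ _ fun i hi => hss' (2 * i) (by omega)
    have h2 : G j (odds s') = G j (odds s) :=
      hGdep j hj _ _ fun i hi => hss' (2 * i + 1) (by omega)
    rw [← h1, ← h2]
    exact hs'.2 j (by omega)
  refine le_asymNorm_of_strategy A _ k _
    -- Invariant: `r • v` tracks `G j (evens s) - G j (odds s)` with error `ε` per step, and `s` can
    -- still be continued generically.
    (fun j v => ∃ s, IterEventually U Q (2 * (k - j)) (2 * j) s ∧
      ‖ι ((r : 𝕜) • v) - (G j (evens s) - G j (odds s))‖ ≤ j * ε) ?_ ?_ ?_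
  · refine ⟨0, hQ, ?_⟩
    rw [hGdep 0 (by omega) (evens 0) (odds 0) (by simp)]
    simp
  · rintro j hj v ⟨s, hs, hv⟩ u
    obtain ⟨F, δ, hδ, hFu⟩ := exists_finset_forall_norm_lt_mem u
    have hwj := hw ⟨j, hj⟩
    set c₀ : ℝ := r * w ⟨j, hj⟩ with hc₀
    have hc₀0 : 0 < c₀ := by positivity
    obtain ⟨l, hl⟩ : ∃ l, k - j = l + 1 := ⟨k - j - 1, by omega⟩
    have hl' : k - (j + 1) = l := by omega
    have hGj : G j = iterLim U g (l + 1) j := by simp only [G, hl]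
    have hGj' : G (j + 1) = iterLim U g l (j + 1) := by simp only [G, hl']
    have hs0 := hnear j hj.le _ s hs
    rw [hl] at hs
    have hs1 : ∀ᶠ a in (U : Filter ℕ), ∀ᶠ b in (U : Filter ℕ), IterEventually U Q (2 * l)
        (2 * (j + 1)) (Function.update (Function.update s (2 * j) a) (2 * j + 1) b) := hs
    -- Choose the next terms of `m` and `n` in turn. The bound `c₀ * δ / 4` is doubled by the
    -- difference, doubled by the passage to `X`, then divided by `c₀`.
    obtain ⟨a, ha, haF⟩ := (hs1.and (eventually_norm_iterLim_succ_sub_lt hR hg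
      (show 0 < c₀ * δ / 4 by positivity) F l j (evens s))).exists
    obtain ⟨c, hc, hcF⟩ := (ha.and (eventually_norm_iterLim_succ_sub_lt hR hg
      (show 0 < c₀ * δ / 4 by positivity) F l j (odds s))).exists
    set s' := Function.update (Function.update s (2 * j) a) (2 * j + 1) c with hs'
    have hev : evens s' = Function.update (evens s) j a := evens_update_update s j a c
    have hod : odds s' = Function.update (odds s) j c := odds_update_update s j a c
    obtain ⟨y, hy⟩ := hs0
    obtain ⟨y', hy'⟩ := hnear (j + 1) (by omega) _ s' hc
    set dm := G (j + 1) (evens s') - G j (evens s) with hdm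
    set dn := G (j + 1) (odds s') - G j (odds s) with hdn
    have hdmn : ‖dm‖ ≤ C * w ⟨j, hj⟩ := by
      rw [hdm, hev, hGj, hGj']
      exact norm_iterLim_succ_sub_le hR hg (hD ⟨j, hj⟩) l _ _
    have hdnn : ‖dn‖ ≤ C * w ⟨j, hj⟩ := by
      rw [hdn, hod, hGj, hGj']
      exact norm_iterLim_succ_sub_le hR hg (hD ⟨j, hj⟩) l _ _
    -- Each of levels `j` and `j + 1` contributes `2 * (ε / 8)`; the passage to `X` doubles the
    -- total to `ε`.
    have hz : ‖(dm - dn) - ι (y' - y)‖ ≤ ε / 2 := by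
      have h1 : (dm - dn) - ι (y' - y) =
          (G (j + 1) (evens s') - G (j + 1) (odds s') - ι y') -
            (G j (evens s) - G j (odds s) - ι y) := by
        rw [map_sub, hdm, hdn]; abel
      rw [h1]
      refine (norm_sub_le _ _).trans ?_
      linarith
    have hzF : ∀ φ ∈ F, ‖(dm - dn) φ‖ < c₀ * δ / 2 := by
      intro φ hφ
      have h1 := haF φ hφ
      have h2 := hcF φ hφ
      rw [← hGj, ← hGj', ← hev, ← hdm] at h1
      rw [← hGj, ← hGj', ← hod, ← hdn] at h2
      rw [sub_apply]
      refine (norm_sub_le _ _).trans_lt ?_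
      linarith
    obtain ⟨x, hx, hxF⟩ := exists_norm_inclusion_sub_le (by positivity) (by positivity) hz hzF
    have hxn : ‖x‖ ≤ c₀ := by
      have h1 := norm_add_le (ι x - (dm - dn)) (dm - dn)
      have h2 := norm_sub_le dm dn
      rw [sub_add_cancel, norm_inclusionInDoubleDual] at h1
      have h3 := hεη ⟨j, hj⟩
      rw [hc₀, hr]
      linarith
    have hc₀𝕜 : (c₀ : 𝕜) ≠ 0 := RCLike.ofReal_ne_zero.2 hc₀0.ne'
    have hcn : ‖(c₀ : 𝕜)⁻¹‖ = c₀⁻¹ := by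
      rw [norm_inv, RCLike.norm_ofReal, abs_of_pos hc₀0]
    refine ⟨(c₀ : 𝕜)⁻¹ • x, ?_, hFu _ fun φ hφ => ?_, s', ?_, ?_⟩
    · rw [norm_smul, hcn, inv_mul_le_iff₀ hc₀0, mul_one]
      exact hxn
    · rw [map_smul, norm_smul, hcn, inv_mul_lt_iff₀ hc₀0]
      exact (hxF φ hφ).trans_le (by linarith)
    · rw [hl']; exact hc
    · have h1 : (r : 𝕜) • (v + toC00 (fun i => (w i : 𝕜)) j • (c₀ : 𝕜)⁻¹ • x) = (r : 𝕜) • v + x := by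
        rw [toC00_apply _ hj, smul_add, smul_smul, smul_smul, ← RCLike.ofReal_mul,
          ← hc₀, mul_inv_cancel₀ hc₀𝕜, one_smul]
      have h2 : ι ((r : 𝕜) • v + x) - (G (j + 1) (evens s') - G (j + 1) (odds s')) =
          (ι ((r : 𝕜) • v) - (G j (evens s) - G j (odds s))) + (ι x - (dm - dn)) := by
        rw [map_add, hdm, hdn]; abel
      rw [h1, h2]
      refine (norm_add_le _ _).trans ?_
      push_cast
      linarith
  · rintro v ⟨s, hs, hv⟩
    simp only [Nat.sub_self, Nat.mul_zero] at hs
    obtain ⟨hs1, -⟩ := (hs : Q s)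
    rw [hGk, hGk] at hv
    simp only [g] at hv
    rw [← map_sub, ← map_sub, norm_inclusionInDoubleDual] at hv
    rw [← ofReal_norm]
    refine ENNReal.ofReal_le_ofReal ?_
    rw [div_le_iff₀ hr0]
    set m := f fun i => evens s i
    set n := f fun i => odds s i
    have h1 : A m - A n = (r : 𝕜) • A v - A ((r : 𝕜) • v - (m - n)) := by
      simp only [map_sub, map_smul]; abel
    have h2 := norm_sub_le ((r : 𝕜) • A v) (A ((r : 𝕜) • v - (m - n)))
    rw [← h1, norm_smul, RCLike.norm_ofReal, abs_of_pos hr0] at h2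
    have h3 := A.le_opNorm_of_le hv
    linarith

end Concentration

end AsymptoticSmoothness

end

noncomputable section

namespace AsymptoticSmoothness

/-! ### Passage to an infinite set, and homogeneity of the seminorm -/

section Concentration

variable {𝕜 : Type*} [RCLike 𝕜]
  {X : Type*} [NormedAddCommGroup X] [NormedSpace 𝕜 X]
  {Y : Type*} [NormedAddCommGroup Y] [NormedSpace 𝕜 Y]

/-- Merging alternately turns an interlaced pair into one increasing sequence of length `2 * k`, the
form Ramsey's theorem handles. -/
theorem Interlaced.exists_sequence {k : ℕ} {m n : Fin k → ℕ} (h : Interlaced m n) :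
    ∃ s : ℕ → ℕ, (∀ i : Fin k, evens s i = m i) ∧ (∀ i : Fin k, odds s i = n i) ∧
      ∀ j < 2 * k, ∀ j' < j, s j' < s j := by
  let s : ℕ → ℕ := fun j =>
    if h : j / 2 < k then (if j % 2 = 0 then m ⟨j / 2, h⟩ else n ⟨j / 2, h⟩) else 0
  have hm : ∀ (i : ℕ) (hi : i < k), s (2 * i) = m ⟨i, hi⟩ := by
    intro i hi
    simp [s, hi]
  have hn : ∀ (i : ℕ) (hi : i < k), s (2 * i + 1) = n ⟨i, hi⟩ := by
    intro i hi
    have h1 : (2 * i + 1) / 2 = i := by omega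
    have h2 : (2 * i + 1) % 2 = 1 := by omega
    simp [s, hi, h1, h2]
  refine ⟨s, fun i => hm i i.2, fun i => hn i i.2, fun j hj j' hj' => ?_⟩
  have hjk : j / 2 < k := by omega
  have hjk' : j' / 2 < k := by omega
  have hle : s j' ≤ n ⟨j' / 2, hjk'⟩ := by
    rcases Nat.even_or_odd' j' with ⟨i, rfl | rfl⟩
    · have hi : i < k := by omega
      have h1 : (⟨2 * i / 2, hjk'⟩ : Fin k) = ⟨i, hi⟩ := Fin.ext (by simp)
      rw [hm i hi, h1]
      exact (h.1 _).le
    · have hi : i < k := by omega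
      have h1 : (⟨(2 * i + 1) / 2, hjk'⟩ : Fin k) = ⟨i, hi⟩ := Fin.ext (by simp only; omega)
      rw [hn i hi, h1]
  have hge : m ⟨j / 2, hjk⟩ ≤ s j := by
    rcases Nat.even_or_odd' j with ⟨i, rfl | rfl⟩
    · have hi : i < k := by omega
      have h1 : (⟨2 * i / 2, hjk⟩ : Fin k) = ⟨i, hi⟩ := Fin.ext (by simp)
      rw [hm i hi, h1]
    · have hi : i < k := by omega
      have h1 : (⟨(2 * i + 1) / 2, hjk⟩ : Fin k) = ⟨i, hi⟩ := Fin.ext (by simp only; omega)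
      rw [hn i hi, h1]
      exact (h.1 _).le
  rcases Nat.lt_or_ge (j' / 2) (j / 2) with hlt | hge'
  · exact hle.trans_lt ((h.2 ⟨j' / 2, hjk'⟩ ⟨j / 2, hjk⟩ hlt).trans_le hge)
  · have hj1 : j' = 2 * (j / 2) := by omega
    have hj2 : s j = n ⟨j / 2, hjk⟩ := by
      rw [← hn (j / 2) hjk]
      congr 1
      omega
    rw [hj1, hm _ hjk, hj2]
    exact h.1 _

theorem exists_infinite_forall_interlaced [CompleteSpace X] (hX : QuasiReflexive 𝕜 X)
    (A : X →L[𝕜] Y) {k : ℕ} {w : Fin k → ℝ} (hw : ∀ i, 0 < w i) {ϑ : ℝ}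
    (hϑ : 2 * asymNorm A (toC00 fun i => (w i : 𝕜)) < ENNReal.ofReal ϑ)
    {f : (Fin k → ℕ) → X} {C : ℝ} (hC : IsLipConst w f C) :
    ∃ M : Set ℕ, M.Infinite ∧ ∀ m n : Fin k → ℕ, (∀ i, m i ∈ M) → (∀ i, n i ∈ M) →
      Interlaced m n → ‖A (f m) - A (f n)‖ ≤ C * ϑ := by
  -- For `C = 0` the map is constant; the gap `D` used below would vanish.
  rcases hC.1.eq_or_lt with rfl | hC0
  · refine ⟨Set.univ, Set.infinite_univ, fun m n _ _ _ => ?_⟩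
    have := hC.2 m n
    rw [zero_mul, norm_le_zero_iff] at this
    rw [← map_sub, this]
    simp
  let U : Ultrafilter ℕ := hyperfilter ℕ
  have hU : (U : Filter ℕ) ≤ atTop := Nat.hyperfilter_le_atTop
  let P : (ℕ → ℕ) → Prop := fun s =>
    ‖A (f fun i => evens s i) - A (f fun i => odds s i)‖ ≤ C * ϑ
  have hPdep : DependsBelow (2 * k) P := by
    intro s s' h
    have h1 : (fun i : Fin k => evens s i) = fun i : Fin k => evens s' i :=
      funext fun i => h _ (by have := i.2; omega)
    have h2 : (fun i : Fin k => odds s i) = fun i : Fin k => odds s' i :=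
      funext fun i => h _ (by have := i.2; omega)
    simp only [P, h1, h2]
  by_cases hP : IterEventually U P (2 * k) 0 0
  · obtain ⟨M, hM, hMP⟩ := hP.exists_infinite hU hPdep
    refine ⟨M, hM, fun m n hm hn hmn => ?_⟩
    obtain ⟨s, hsm, hsn, hmono⟩ := hmn.exists_sequence
    have h1 : (fun i : Fin k => evens s i) = m := funext hsm
    have h2 : (fun i : Fin k => odds s i) = n := funext hsn
    have := hMP s (fun j hj => ?_) hmono
    · simpa only [P, h1, h2] using this
    · rcases Nat.even_or_odd' j with ⟨i, rfl | rfl⟩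
      · have := hsm ⟨i, by omega⟩
        simp only [evens] at this
        rw [this]; exact hm _
      · have := hsn ⟨i, by omega⟩
        simp only [odds] at this
        rw [this]; exact hn _
  · exfalso
    have hb : IterEventually U
        (fun s => C * ϑ < ‖A (f fun i => evens s i) - A (f fun i => odds s i)‖) (2 * k) 0 0 :=
      IterEventually.mono (fun s hs => not_le.1 hs) _ _ _ (IterEventually.not _ _ _ hP)
    have htop : asymNorm A (toC00 fun i => (w i : 𝕜)) ≠ ∞ := by
      intro h
      rw [h] at hϑ
      simp at hϑ
    obtain ⟨S, hS0, hS⟩ : ∃ S : ℝ, 0 ≤ S ∧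
        asymNorm A (toC00 fun i => (w i : 𝕜)) = ENNReal.ofReal S :=
      ⟨_, ENNReal.toReal_nonneg, (ENNReal.ofReal_toReal htop).symm⟩
    have hSϑ : 2 * S < ϑ := by
      rw [hS, ← ENNReal.ofReal_ofNat, ← ENNReal.ofReal_mul (by norm_num)] at hϑ
      exact (ENNReal.ofReal_lt_ofReal_iff_of_nonneg (by positivity)).1 hϑ
    set D : ℝ := C * (ϑ - 2 * S) with hD
    have hD0 : 0 < D := mul_pos hC0 (by linarith)
    -- The lower bound gives `D ≤ 2 * η * S + ‖A‖ * (k * ε)`; `η` and then `ε` keep the first term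
    -- at most, and the second below, `D / 2`.
    set η : ℝ := D / (4 * (S + 1)) with hη
    have hη0 : 0 < η := by positivity
    have hηS : 2 * η * S ≤ D / 2 := by
      have : η * (4 * (S + 1)) = D := div_mul_cancel₀ _ (by positivity)
      nlinarith
    have hε : ∀ᶠ ε in 𝓝[>] (0 : ℝ), 0 < ε ∧ (∀ i, ε ≤ 2 * η * w i) ∧ ‖A‖ * (k * ε) < D / 2 := by
      refine (eventually_mem_nhdsWithin).and ((eventually_all.2 fun i => ?_).and ?_)
      · have h1 : 0 < 2 * η * w i := mul_pos (by positivity) (hw i)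
        exact mem_nhdsWithin_of_mem_nhds ((eventually_lt_nhds h1).mono fun _ h => le_of_lt h)
      · have h1 : Tendsto (fun ε : ℝ => ‖A‖ * (k * ε)) (𝓝 0) (𝓝 (‖A‖ * (k * 0))) :=
          (continuous_const.mul (continuous_const.mul continuous_id)).tendsto 0
        rw [mul_zero, mul_zero] at h1
        exact mem_nhdsWithin_of_mem_nhds (h1.eventually (eventually_lt_nhds (half_pos hD0)))
    obtain ⟨ε, hε0, hεη, hεA⟩ := hε.exists
    have key := le_asymNorm_of_iterEventually hX A U hw hC hη0 hε0 hεη hb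
    rw [hS, ENNReal.ofReal_le_ofReal_iff hS0, div_le_iff₀ (by positivity)] at key
    linarith

theorem exists_infinite_forall_interlaced_of_le [CompleteSpace X] (hX : QuasiReflexive 𝕜 X)
    (A : X →L[𝕜] Y) {k : ℕ} {w : Fin k → ℝ} (hw : ∀ i, 0 < w i) {B : ℝ} (hB : 0 < B)
    (hAB : asymNorm A (toC00 fun i => (w i : 𝕜)) ≤ ENNReal.ofReal B) {ϑ : ℝ} (hϑ : 2 < ϑ)
    {f : (Fin k → ℕ) → X} {C : ℝ} (hC : IsLipConst w f C) :
    ∃ M : Set ℕ, M.Infinite ∧ ∀ m n : Fin k → ℕ, (∀ i, m i ∈ M) → (∀ i, n i ∈ M) →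
      Interlaced m n → ‖A (f m) - A (f n)‖ ≤ C * (ϑ * B) := by
  refine exists_infinite_forall_interlaced hX A hw (lt_of_le_of_lt (mul_le_mul_right hAB 2) ?_) hC
  rw [← ENNReal.ofReal_ofNat, ← ENNReal.ofReal_mul (by norm_num),
    ENNReal.ofReal_lt_ofReal_iff (by positivity)]
  exact mul_lt_mul_of_pos_right hϑ hB

/-- The scalar factors out of every branch; `c ≠ 0` lets it pass through the infimum in `ℝ≥0∞`. -/
theorem asymNorm_smul_le (A : X →L[𝕜] Y) {c : 𝕜} (hc : c ≠ 0) (a : ℕ →₀ 𝕜) :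
    asymNorm A (c • a) ≤ ‖c‖ₑ * asymNorm A a := by
  refine iSup_le fun n => iSup_le fun x => iSup_le fun hx => ?_
  calc _ = ‖c‖ₑ * ⨅ (t : List (WeakNhd 𝕜 X)) (_ : t.length = n),
        ‖A (∑ i ∈ Finset.range n, a i • x (t.take (i + 1)))‖ₑ := by
        have hc0 : ‖c‖ₑ ≠ 0 := by simpa using hc
        simp only [ENNReal.mul_iInf_of_ne hc0 enorm_ne_top]
        congr! 4 with t ht
        rw [← enorm_smul, ← map_smul, Finset.smul_sum]
        simp only [Finsupp.smul_apply, smul_eq_mul, mul_smul]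
    _ ≤ _ := by
        gcongr
        exact le_iSup_of_le n (le_iSup_of_le x (le_iSup_of_le hx le_rfl))

theorem smul_toC00 {n : ℕ} (c : 𝕜) (a : Fin n → 𝕜) :
    c • toC00 a = toC00 fun i => c * a i := by
  simp [toC00, Finset.smul_sum]

theorem norm_toLp_ofReal {p : ℝ≥0∞} (hp : 1 < p) {k : ℕ} (w : Fin k → ℝ) :
    ‖(WithLp.toLp p fun i => (w i : 𝕜) : PiLp p fun _ : Fin k => 𝕜)‖ =
      ‖(WithLp.toLp p w : PiLp p fun _ : Fin k => ℝ)‖ := by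
  rcases eq_or_ne p ∞ with rfl | hp'
  · simp [PiLp.norm_eq_ciSup]
  · have : 0 < p.toReal := ENNReal.toReal_pos (zero_lt_one.trans hp).ne' hp'
    simp [PiLp.norm_eq_sum this]

theorem asymNorm_toC00_le_alpha {p : ℝ≥0∞} (hp : 1 < p) (A : X →L[𝕜] Y) {k : ℕ} {w : Fin k → ℝ}
    (hw : 0 < ‖(WithLp.toLp p w : PiLp p fun _ : Fin k => ℝ)‖) :
    asymNorm A (toC00 fun i => (w i : 𝕜)) ≤
      ENNReal.ofReal ‖(WithLp.toLp p w : PiLp p fun _ : Fin k => ℝ)‖ * alpha p A := by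
  have : Fact (1 ≤ p) := ⟨hp.le⟩
  set N := ‖(WithLp.toLp p w : PiLp p fun _ : Fin k => ℝ)‖ with hN
  have hN0 : (N : 𝕜) ≠ 0 := RCLike.ofReal_ne_zero.2 hw.ne'
  let a : PiLp p fun _ : Fin k => 𝕜 := (N : 𝕜)⁻¹ • WithLp.toLp p fun i => (w i : 𝕜)
  have ha : ‖a‖ ≤ 1 := by
    rw [norm_smul, norm_toLp_ofReal hp, ← hN, norm_inv, RCLike.norm_ofReal, abs_of_pos hw,
      inv_mul_cancel₀ hw.ne']
  have h1 : toC00 (fun i => (w i : 𝕜)) = (N : 𝕜) • toC00 fun i => a i := by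
    rw [smul_toC00]
    congr 1
    funext i
    simp [a, hN0]
  have h2 : ‖(N : 𝕜)‖ₑ = ENNReal.ofReal N := by
    rw [← ofReal_norm, RCLike.norm_ofReal, abs_of_pos hw]
  rw [h1]
  refine (asymNorm_smul_le A hN0 _).trans ?_
  rw [h2]
  gcongr
  exact le_iSup_of_le k (le_iSup_of_le a (le_iSup_of_le ha le_rfl))

/-- Write `∑ e_i` as `k` times its average and split `k = k^(1/p) * k^(1/q)`. -/
theorem asymNorm_toC00_one_le_bigN (p : ℝ≥0∞) (A : X →L[𝕜] Y) {k : ℕ} (hk : 1 ≤ k) :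
    asymNorm A (toC00 fun _ : Fin k => ((1 : ℝ) : 𝕜)) ≤
      (k : ℝ≥0∞) ^ (p⁻¹).toReal * bigN p A := by
  have hk𝕜 : (k : 𝕜) ≠ 0 := Nat.cast_ne_zero.2 (by omega)
  have hk0 : (k : ℝ≥0∞) ≠ 0 := Nat.cast_ne_zero.2 (by omega)
  have h1 : toC00 (fun _ : Fin k => ((1 : ℝ) : 𝕜)) = (k : 𝕜) • toC00 fun _ : Fin k => (k : 𝕜)⁻¹ := by
    rw [smul_toC00]
    congr 1
    funext i
    simp [hk𝕜]
  have h2 : ‖(k : 𝕜)‖ₑ = (k : ℝ≥0∞) ^ (p⁻¹).toReal * (k : ℝ≥0∞) ^ (1 - (p⁻¹).toReal) := by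
    rw [← ENNReal.rpow_add _ _ hk0 (ENNReal.natCast_ne_top k), add_sub_cancel, ENNReal.rpow_one,
      ← ofReal_norm, RCLike.norm_natCast, ENNReal.ofReal_natCast]
  rw [h1]
  refine (asymNorm_smul_le A hk𝕜 _).trans ?_
  rw [h2, mul_assoc]
  gcongr
  exact le_iSup_of_le k (le_iSup_of_le hk le_rfl)

end Concentration

end AsymptoticSmoothness

end

theorem mainTheorem6 {𝕜 : Type*} [RCLike 𝕜]
    {X : Type*} [NormedAddCommGroup X] [NormedSpace 𝕜 X] [CompleteSpace X]
    {Y : Type*} [NormedAddCommGroup Y] [NormedSpace 𝕜 Y] [CompleteSpace Y]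
    (p : ℝ≥0∞) (hp : 1 < p) (hX : AsymptoticSmoothness.QuasiReflexive 𝕜 X) (A : X →L[𝕜] Y) :
    (∀ (k : ℕ) (w : Fin k → ℝ), (∀ i, 0 < w i) →
      ∀ ϑ : ℝ, 2 * AsymptoticSmoothness.asymNorm A
          (AsymptoticSmoothness.toC00 (fun i => (w i : 𝕜))) < ENNReal.ofReal ϑ →
      ∀ f : (Fin k → ℕ) → X, AsymptoticSmoothness.IsLipschitz w f →
      ∃ M : Set ℕ, M.Infinite ∧
        ∀ m n : Fin k → ℕ, (∀ i, m i ∈ M) → (∀ i, n i ∈ M) →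
          AsymptoticSmoothness.Interlaced m n →
          ‖A (f m) - A (f n)‖ ≤ AsymptoticSmoothness.lip w f * ϑ) ∧
    (AsymptoticSmoothness.ClassA p A → 0 < AsymptoticSmoothness.alpha p A →
      ∀ ϑ : ℝ, 2 < ϑ → ∀ (k : ℕ) (w : Fin k → ℝ), (∀ i, 0 < w i) →
      ∀ f : (Fin k → ℕ) → X, AsymptoticSmoothness.IsLipschitz w f →
      ∃ M : Set ℕ, M.Infinite ∧
        ∀ m n : Fin k → ℕ, (∀ i, m i ∈ M) → (∀ i, n i ∈ M) →
          AsymptoticSmoothness.Interlaced m n →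
          ‖A (f m) - A (f n)‖ ≤ ϑ * AsymptoticSmoothness.lip w f *
            (AsymptoticSmoothness.alpha p A).toReal *
            ‖(WithLp.toLp p w : PiLp p (fun _ : Fin k => ℝ))‖) ∧
    (AsymptoticSmoothness.ClassN p A → 0 < AsymptoticSmoothness.bigN p A →
      ∀ ϑ : ℝ, 2 < ϑ → ∀ (k : ℕ) (f : (Fin k → ℕ) → X),
      AsymptoticSmoothness.IsLipschitz (fun _ => 1) f →
      ∃ M : Set ℕ, M.Infinite ∧
        ∀ m n : Fin k → ℕ, (∀ i, m i ∈ M) → (∀ i, n i ∈ M) →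
          AsymptoticSmoothness.Interlaced m n →
          ‖A (f m) - A (f n)‖ ≤ ϑ * AsymptoticSmoothness.lip (fun _ => 1) f *
            (AsymptoticSmoothness.bigN p A).toReal * (k : ℝ) ^ (p⁻¹).toReal) := by
  refine ⟨fun k w hw ϑ hϑ f hf => ?_, fun hA hA0 ϑ hϑ k w hw f hf => ?_,
    fun hA hA0 ϑ hϑ k f hf => ?_⟩
  · exact AsymptoticSmoothness.exists_infinite_forall_interlaced hX A hw hϑ
      (AsymptoticSmoothness.isLipConst_lip hf)
  -- For `k = 0` the norm of `w` vanishes, so the positive bound `B` is unavailable, but the graph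
  -- is a single point.
  · rcases Nat.eq_zero_or_pos k with rfl | hk
    · refine ⟨Set.univ, Set.infinite_univ, fun m n _ _ _ => ?_⟩
      have hlip := (AsymptoticSmoothness.isLipConst_lip hf).1
      have : Fact (1 ≤ p) := ⟨hp.le⟩
      rw [Subsingleton.elim m n, sub_self, norm_zero]
      positivity
    have hN : 0 < ‖(WithLp.toLp p w : PiLp p (fun _ : Fin k => ℝ))‖ := by
      have : Fact (1 ≤ p) := ⟨hp.le⟩
      rw [norm_pos_iff]
      intro h
      have h1 : w ⟨0, hk⟩ = 0 := congrArg (fun v : PiLp p (fun _ : Fin k => ℝ) => v ⟨0, hk⟩) h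
      exact (hw _).ne' h1
    have hα : 0 < (AsymptoticSmoothness.alpha p A).toReal := ENNReal.toReal_pos hA0.ne' hA.ne
    have hle := AsymptoticSmoothness.asymNorm_toC00_le_alpha (𝕜 := 𝕜) hp A hN
    rw [← ENNReal.ofReal_toReal hA.ne, ← ENNReal.ofReal_mul hN.le] at hle
    obtain ⟨M, hM, h⟩ := AsymptoticSmoothness.exists_infinite_forall_interlaced_of_le hX A hw
      (mul_pos hN hα) hle hϑ (AsymptoticSmoothness.isLipConst_lip hf)
    exact ⟨M, hM, fun m n hm hn hmn => (h m n hm hn hmn).trans_eq (by ring)⟩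
  · rcases Nat.eq_zero_or_pos k with rfl | hk
    · refine ⟨Set.univ, Set.infinite_univ, fun m n _ _ _ => ?_⟩
      have hlip := (AsymptoticSmoothness.isLipConst_lip hf).1
      rw [Subsingleton.elim m n, sub_self, norm_zero]
      positivity
    have hN : 0 < (k : ℝ) ^ (p⁻¹).toReal := Real.rpow_pos_of_pos (Nat.cast_pos.2 hk) _
    have hα : 0 < (AsymptoticSmoothness.bigN p A).toReal := ENNReal.toReal_pos hA0.ne' hA.ne
    have hle := AsymptoticSmoothness.asymNorm_toC00_one_le_bigN p A hk
    rw [← ENNReal.ofReal_toReal hA.ne, ← ENNReal.ofReal_natCast,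
      ENNReal.ofReal_rpow_of_pos (Nat.cast_pos.2 hk), ← ENNReal.ofReal_mul hN.le] at hle
    obtain ⟨M, hM, h⟩ := AsymptoticSmoothness.exists_infinite_forall_interlaced_of_le hX A
      (fun _ => one_pos) (mul_pos hN hα) hle hϑ (AsymptoticSmoothness.isLipConst_lip hf)
    exact ⟨M, hM, fun m n hm hn hmn => (h m n hm hn hmn).trans_eq (by ring)⟩
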